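/- Let $\Omega\subset\mathbb C^m$ be a bounded domain and let $K:\Omega\times\Omega\to\mathbb C$ be sesqui-analytic (holomorphic in the first and anti-holomorphic in the second variable) and such that a continuous branch $\log K$ of the logarithm of $K$ exists on $\Omega\times\Omega$. For real $t$ put $K^t=\exp(t\log K)$. Let $\alpha,\beta>0$ be such that $K^\alpha$ and $K^\beta$ are non-negative definite on $\Omega\times\Omega$. For a non-negative definite kernel $k$ on $\Omega$, scalar or matrix valued, let $(\mathcal H,k)$ denote its reproducing kernel Hilbert space, and regard $(\mathcal H,K^\alpha)\otimes(\mathcal H,K^\beta)$ as a Hilbert space of functions $f(z,\zeta)$ on $\Omega\times\Omega$, with $f\otimes g$ being the function $f(z)g(\zeta)$. Suppose that the multiplication operators $M_{z_i}$, $i=1,\dots,m$, by the coordinate functions are bounded on both $(\mathcal H,K^\alpha)$ and $(\mathcal H,K^\beta)$. Let $\Delta=\{(z,z):z\in\Omega\}$, let $\partial_j$ be the derivative with respect to the $j$-th of the $2m$ variables $(z,\zeta)$, and put $$\mathcal A_0=\{f\in(\mathcal H,K^\alpha)\otimes(\mathcal H,K^\beta): f|_\Delta=0\},\qquad \mathcal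 A_1=\{f\in\mathcal A_0:(\partial_{m+1}f)|_\Delta=\dots=(\partial_{2m}f)|_\Delta=0\},\qquad \mathcal S_1=\mathcal A_0\ominus\mathcal A_1,$$ $$\mathcal R_1(f)=\frac1{\sqrt{\alpha\beta(\alpha+\beta)}}\big((\beta\,\partial_jf-\alpha\,\partial_{m+j}f)|_\Delta\big)_{j=1}^m,\qquad \mathbb K^{(\alpha,\beta)}=K^{\alpha+\beta}\big(\partial_i\bar\partial_j\log K\big)_{i,j=1}^m .$$ Then: (a) pointwise multiplication by polynomials makes $(\mathcal H,K^\alpha)\otimes(\mathcal H,K^\beta)$ a Hilbert module over $\mathbb C[z_1,\dots,z_{2m}]$ (every polynomial acts as a bounded operator), and $\mathcal S_1$ with the compressed action $p\cdot h=P_{\mathcal S_1}(ph)$ is a Hilbert module over $\mathbb C[z_1,\dots,z_{2m}]$, where $P_{\mathcal S_1}$ is the orthogonal projection onto $\mathcal S_1$; (b) $\mathbb K^{(\alpha,\beta)}$ is a non-negative definite kernel on $\Omega$ with values in the $m\times m$ matrices, and $(\mathcal H,\mathbb K^{(\alpha,\beta)})$ is a Hilbert module over $\mathbb C[z_1,\dots,z_m]$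 under pointwise multiplication; (c) $\mathcal R_1|_{\mathcal S_1}$ is a unitary operator from $\mathcal S_1$ onto $(\mathcal H,\mathbb K^{(\alpha,\beta)})$, and $$\mathcal R_1\big(P_{\mathcal S_1}(ph)\big)=(p\circ\iota)\,\mathcal R_1(h),\qquad h\in\mathcal S_1,\ p\in\mathbb C[z_1,\dots,z_{2m}],\quad \iota(z)=(z,z).$$ That is, $\mathcal S_1$ is isomorphic, via $\mathcal R_1|_{\mathcal S_1}$, to the push-forward module $\iota_\star(\mathcal H,\mathbb K^{(\alpha,\beta)})$, in which $p\in\mathbb C[z_1,\dots,z_{2m}]$ acts as multiplication by $p\circ\iota$. -/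

import Mathlib

open scoped TensorProduct InnerProductSpace ComplexConjugate

noncomputable section

namespace TwoBox

/-! ### Partial derivatives -/

/-- The holomorphic partial derivative `∂ g / ∂ z_i` at `z`. -/
def pd {m : ℕ} (i : Fin m) (g : (Fin m → ℂ) → ℂ) (z : Fin m → ℂ) : ℂ :=
  lineDeriv ℂ g z (Pi.single i 1)

/-- The antiholomorphic partial derivative `∂ g / ∂ w̄_j` at `w`, for antiholomorphic `g`:
the conjugate of the holomorphic derivative of the conjugate of `g`. -/
def pdbar {m : ℕ} (j : Fin m) (g : (Fin m → ℂ) → ℂ) (w : Fin m → ℂ) : ℂ :=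
  conj (pd j (fun w' => conj (g w')) w)

/-- The partial derivative at a point of `Ω` of a function that is only defined on `Ω`.
For open `Ω` the values of the extension outside `Ω` play no role. -/
def pdOn {m : ℕ} {Ω : Set (Fin m → ℂ)} (i : Fin m) (g : Ω → ℂ) (z : Ω) : ℂ :=
  pd i (Function.extend Subtype.val g 0) z

/-! ### Sesqui-analytic functions, logarithms, powers and the associated kernels -/

/-- `K` is holomorphic in the first and antiholomorphic in the second variable on `Ω × Ω`, i.e.
`(z, w) ↦ K (z, w̄)` is holomorphic on `Ω × Ω̄`, with `Ω̄` the set of conjugates of points of `Ω`. -/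
def IsSesquiAnalytic {m : ℕ} (Ω : Set (Fin m → ℂ)) (K : (Fin m → ℂ) → (Fin m → ℂ) → ℂ) : Prop :=
  DifferentiableOn ℂ (fun p : (Fin m → ℂ) × (Fin m → ℂ) => K p.1 (star p.2))
    {p | p.1 ∈ Ω ∧ star p.2 ∈ Ω}

/-- `L` is a continuous branch of `log K` on `Ω × Ω`. -/
def IsLogBranch {m : ℕ} (Ω : Set (Fin m → ℂ)) (K L : (Fin m → ℂ) → (Fin m → ℂ) → ℂ) : Prop :=
  ContinuousOn (fun p : (Fin m → ℂ) × (Fin m → ℂ) => L p.1 p.2) (Ω ×ˢ Ω) ∧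
    ∀ z ∈ Ω, ∀ w ∈ Ω, Complex.exp (L z w) = K z w

/-- The real power `K ^ t = exp (t log K)`, for the branch `L` of `log K`. -/
def kpow {m : ℕ} (L : (Fin m → ℂ) → (Fin m → ℂ) → ℂ) (t : ℝ) (z w : Fin m → ℂ) : ℂ :=
  Complex.exp ((t : ℂ) * L z w)

/-- The scalar kernel `K ^ t` on `Ω × Ω`; the scalar `c` is the operator `c • id` on `ℂ`. -/
def powKernel {m : ℕ} (Ω : Set (Fin m → ℂ)) (L : (Fin m → ℂ) → (Fin m → ℂ) → ℂ) (t : ℝ) :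
    Matrix Ω Ω (ℂ →L[ℂ] ℂ) :=
  Matrix.of fun z w => kpow L t z w • ContinuousLinearMap.id ℂ ℂ

/-- The `m × m` matrix valued kernel `K ^ (α + β) (∂_i ∂̄_j log K)_{i,j}` on `Ω × Ω`. -/
def curvKernel {m : ℕ} (Ω : Set (Fin m → ℂ)) (L : (Fin m → ℂ) → (Fin m → ℂ) → ℂ) (α β : ℝ) :
    Matrix Ω Ω (EuclideanSpace ℂ (Fin m) →L[ℂ] EuclideanSpace ℂ (Fin m)) :=
  Matrix.of fun z w => Matrix.toEuclideanCLM (n := Fin m) (𝕜 := ℂ)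
    (Matrix.of fun i j : Fin m =>
      kpow L (α + β) z w * pd i (fun z' => pdbar j (fun w' => L z' w') w) z)

/-! ### Hilbert tensor products of reproducing kernel Hilbert spaces -/

/-- The Hilbert space tensor product. -/
abbrev HilbertTensor (H₁ H₂ : Type*) [NormedAddCommGroup H₁] [InnerProductSpace ℂ H₁]
    [NormedAddCommGroup H₂] [InnerProductSpace ℂ H₂] : Type _ :=
  UniformSpace.Completion (H₁ ⊗[ℂ] H₂)

section Tensor

variable {X Y H₁ H₂ : Type*} [NormedAddCommGroup H₁] [InnerProductSpace ℂ H₁] [CompleteSpace H₁]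
  [NormedAddCommGroup H₂] [InnerProductSpace ℂ H₂] [CompleteSpace H₂]
  [RKHS ℂ H₁ X ℂ] [RKHS ℂ H₂ Y ℂ]

/-- The vector `K₁(·, x) ⊗ K₂(·, y)`. -/
def kerTensor (x : X) (y : Y) : HilbertTensor H₁ H₂ :=
  ((RKHS.kerFun H₁ x 1 ⊗ₜ[ℂ] RKHS.kerFun H₂ y 1 : H₁ ⊗[ℂ] H₂) : HilbertTensor H₁ H₂)

theorem inner_kerTensor_tmul (x : X) (y : Y) (f : H₁) (g : H₂) :
    ⟪(kerTensor x y : HilbertTensor H₁ H₂), ((f ⊗ₜ[ℂ] g : H₁ ⊗[ℂ] H₂) : HilbertTensor H₁ H₂)⟫_ℂ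
      = f x * g y := by
  simp [kerTensor]

theorem eq_zero_of_inner_kerTensor (F : HilbertTensor H₁ H₂)
    (h : ∀ (x : X) (y : Y), ⟪(kerTensor x y : HilbertTensor H₁ H₂), F⟫_ℂ = 0) : F = 0 := by
  have dense₁ : ∀ φ : H₁ →L[ℂ] ℂ, (∀ x : X, φ (RKHS.kerFun H₁ x 1) = 0) → ∀ f, φ f = 0 := by
    intro φ hφ f
    have hle : Submodule.topologicalClosure (Submodule.span ℂ {RKHS.kerFun H₁ x v | (x) (v)})
        ≤ LinearMap.ker φ.toLinearMap := by
      refine Submodule.topologicalClosure_minimal _ (Submodule.span_le.mpr ?_) φ.isClosed_ker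
      rintro _ ⟨x, v, rfl⟩
      have : RKHS.kerFun H₁ x v = v • RKHS.kerFun H₁ x 1 := by rw [← map_smul]; simp
      simp [this, hφ x]
    rw [RKHS.kerFun_dense] at hle
    simpa using hle (Submodule.mem_top (x := f))
  have dense₂ : ∀ φ : H₂ →L[ℂ] ℂ, (∀ y : Y, φ (RKHS.kerFun H₂ y 1) = 0) → ∀ g, φ g = 0 := by
    intro φ hφ g
    have hle : Submodule.topologicalClosure (Submodule.span ℂ {RKHS.kerFun H₂ y v | (y) (v)})
        ≤ LinearMap.ker φ.toLinearMap := by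
      refine Submodule.topologicalClosure_minimal _ (Submodule.span_le.mpr ?_) φ.isClosed_ker
      rintro _ ⟨y, v, rfl⟩
      have : RKHS.kerFun H₂ y v = v • RKHS.kerFun H₂ y 1 := by rw [← map_smul]; simp
      simp [this, hφ y]
    rw [RKHS.kerFun_dense] at hle
    simpa using hle (Submodule.mem_top (x := g))
  let B : H₁ →L[ℂ] H₂ →L[ℂ] H₁ ⊗[ℂ] H₂ := TensorProduct.mkL ℂ H₁ H₂
  let ψ : H₁ ⊗[ℂ] H₂ →L[ℂ] ℂ := (innerSL ℂ F).comp UniformSpace.Completion.toComplL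
  have hψ : ∀ t : H₁ ⊗[ℂ] H₂, ψ t = ⟪F, (t : HilbertTensor H₁ H₂)⟫_ℂ := fun t => rfl
  have key : ∀ (f : H₁) (g : H₂), ψ (f ⊗ₜ[ℂ] g) = 0 := by
    intro f
    refine dense₂ (ψ.comp (B f)) fun y => ?_
    refine dense₁ (ψ.comp (B.flip (RKHS.kerFun H₂ y 1))) (fun x => ?_) f
    change ψ (RKHS.kerFun H₁ x 1 ⊗ₜ[ℂ] RKHS.kerFun H₂ y 1) = 0
    rw [hψ]
    exact inner_eq_zero_symm.mp (h x y)
  have hall : ∀ t : H₁ ⊗[ℂ] H₂, ψ t = 0 := by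
    intro t
    induction t using TensorProduct.induction_on with
    | zero => exact map_zero ψ
    | tmul f g => exact key f g
    | add a b ha hb => rw [map_add, ha, hb, add_zero]
  exact UniformSpace.Completion.denseRange_coe.eq_zero_of_inner_left ℂ fun t => hall t

/-- The Hilbert tensor product of two reproducing kernel Hilbert spaces, realized as a space of
functions on `X × Y`: the element `f ⊗ g` is the function `(x, y) ↦ f x * g y`. -/
instance instRKHSTensor : RKHS ℂ (HilbertTensor H₁ H₂) (X × Y) ℂ where
  coeCLM := ContinuousLinearMap.pi fun p =>
    innerSL ℂ (kerTensor p.1 p.2 : HilbertTensor H₁ H₂)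
  coeCLM_injective := by
    refine (injective_iff_map_eq_zero _).mpr fun F hF => ?_
    exact eq_zero_of_inner_kerTensor F fun x y => by simpa using congrFun hF (x, y)

theorem tensor_apply_tmul (f : H₁) (g : H₂) (p : X × Y) :
    ((f ⊗ₜ[ℂ] g : H₁ ⊗[ℂ] H₂) : HilbertTensor H₁ H₂) p = f p.1 * g p.2 :=
  inner_kerTensor_tmul p.1 p.2 f g

end Tensor

/-- The reproducing kernel Hilbert space `(H, K ^ t)`. -/
abbrev PowSpace {m : ℕ} (Ω : Set (Fin m → ℂ)) (L : (Fin m → ℂ) → (Fin m → ℂ) → ℂ) (t : ℝ)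
    [Fact (powKernel Ω L t).PosSemidef] : Type _ :=
  RKHS.OfKernel (powKernel Ω L t)

/-- The reproducing kernel Hilbert space of the kernel `K ^ (α + β) (∂_i ∂̄_j log K)_{i,j}`. -/
abbrev CurvSpace {m : ℕ} (Ω : Set (Fin m → ℂ)) (L : (Fin m → ℂ) → (Fin m → ℂ) → ℂ) (α β : ℝ)
    [Fact (curvKernel Ω L α β).PosSemidef] : Type _ :=
  RKHS.OfKernel (curvKernel Ω L α β)

/-- The Hilbert space tensor product `(H, K ^ α) ⊗ (H, K ^ β)`. -/
abbrev PowTensor {m : ℕ} (Ω : Set (Fin m → ℂ)) (L : (Fin m → ℂ) → (Fin m → ℂ) → ℂ) (α β : ℝ)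
    [Fact (powKernel Ω L α).PosSemidef] [Fact (powKernel Ω L β).PosSemidef] : Type _ :=
  HilbertTensor (PowSpace Ω L α) (PowSpace Ω L β)

/-! ### Hilbert modules -/

/-- A Hilbert module structure over a unital complex algebra `A` on the Hilbert space `H`:
every `a : A` acts by a bounded operator, compatibly with the algebra operations. -/
abbrev HilbertModule (A H : Type*) [CommRing A] [Algebra ℂ A]
    [NormedAddCommGroup H] [InnerProductSpace ℂ H] : Type _ :=
  A →ₐ[ℂ] (H →L[ℂ] H)

/-- The polynomial `p` acts on the function space `H` by pointwise multiplication; `c x` are the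
coordinates of the point `x`. -/
def IsMultiplicationModule {σ X V H : Type*} [NormedAddCommGroup V] [InnerProductSpace ℂ V]
    [NormedAddCommGroup H] [InnerProductSpace ℂ H] [RKHS ℂ H X V] (c : X → σ → ℂ)
    (ρ : HilbertModule (MvPolynomial σ ℂ) H) : Prop :=
  ∀ (p : MvPolynomial σ ℂ) (f : H) (x : X), ρ p f x = MvPolynomial.eval (c x) p • f x

/-- Multiplication by the `i`-th coordinate is a bounded operator on `H`. -/
def CoordMulBounded {m : ℕ} {Ω : Set (Fin m → ℂ)} {V : Type*} [NormedAddCommGroup V]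
    [InnerProductSpace ℂ V] (H : Type*) [NormedAddCommGroup H] [InnerProductSpace ℂ H]
    [RKHS ℂ H Ω V] (i : Fin m) : Prop :=
  ∃ T : H →L[ℂ] H, ∀ (f : H) (z : Ω), T f z = (z : Fin m → ℂ) i • f z

/-- The `2m` coordinates of a point of `Ω × Ω`: the `z_i` are indexed by `Sum.inl i`, the
`z_{m+i}` by `Sum.inr i`. -/
def coord₂ {m : ℕ} {Ω : Set (Fin m → ℂ)} (p : Ω × Ω) : Fin m ⊕ Fin m → ℂ :=
  Sum.elim (p.1 : Fin m → ℂ) (p.2 : Fin m → ℂ)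

/-- The push-forward under `ι : z ↦ (z, z)`: the polynomial `p` in `2m` variables acts as the
polynomial `p ∘ ι` in `m` variables. -/
def pushForward {m : ℕ} {H : Type*} [NormedAddCommGroup H] [InnerProductSpace ℂ H]
    (ρ : HilbertModule (MvPolynomial (Fin m) ℂ) H) :
    HilbertModule (MvPolynomial (Fin m ⊕ Fin m) ℂ) H :=
  ρ.comp (MvPolynomial.rename (Sum.elim id id))

/-- `τ` is the compression of the module action `ρ` to the subspace `S`. -/
def IsCompression {A H : Type*} [CommRing A] [Algebra ℂ A]
    [NormedAddCommGroup H] [InnerProductSpace ℂ H] (S : Submodule ℂ H) [S.HasOrthogonalProjection]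
    (ρ : HilbertModule A H) (τ : HilbertModule A S) : Prop :=
  ∀ (a : A) (h : S), τ a h = S.orthogonalProjectionOnto (ρ a h)

/-! ### The spaces `A₀`, `A₁`, `S₁` and the map `R₁` -/

section Spaces

variable {m : ℕ} {Ω : Set (Fin m → ℂ)} (H : Type*) [NormedAddCommGroup H]
  [InnerProductSpace ℂ H] [RKHS ℂ H (Ω × Ω) ℂ]

/-- The functions that vanish on the diagonal. -/
def A₀ : Submodule ℂ H where
  carrier := {f | ∀ z : Ω, f (z, z) = 0}
  add_mem' := fun {f g} hf hg z => by simp [hf z, hg z]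
  zero_mem' := fun z => by simp
  smul_mem' := fun c f hf z => by simp [hf z]

/-- The functions that vanish on the diagonal along with their partial derivatives
`∂_{m+1}, …, ∂_{2m}`. -/
def A₁ : Set H :=
  {f | f ∈ A₀ H ∧ ∀ (i : Fin m) (z : Ω), pdOn i (fun ζ : Ω => f (z, ζ)) z = 0}

/-- `S₁ = A₀ ⊖ A₁`, the orthogonal complement of `A₁` in `A₀`. -/
def S₁ : Submodule ℂ H := A₀ H ⊓ (Submodule.span ℂ (A₁ H))ᗮ

instance instS₁Proj [CompleteSpace H] : (S₁ H).HasOrthogonalProjection := by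
  have h0 : IsClosed (A₀ H : Set H) := by
    have : (A₀ H : Set H) = ⋂ z : Ω, {f : H | f (z, z) = 0} := by
      ext f
      simp [A₀]
    rw [this]
    exact isClosed_iInter fun z => isClosed_eq (RKHS.continuous_eval _) continuous_const
  have h1 : IsClosed (S₁ H : Set H) := h0.inter (Submodule.isClosed_orthogonal _)
  have : CompleteSpace (S₁ H) := h1.completeSpace_coe
  infer_instance

variable {H}

/-- The map `R₁ f = (αβ(α+β))^{-1/2} ((β ∂_j f - α ∂_{m+j} f)|_Δ)_j`. -/
def R₁ (α β : ℝ) (f : H) (z : Ω) : EuclideanSpace ℂ (Fin m) :=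
  WithLp.toLp 2 fun j =>
    ((1 / Real.sqrt (α * β * (α + β)) : ℝ) : ℂ) *
      ((β : ℂ) * pdOn j (fun x : Ω => f (x, z)) z - (α : ℂ) * pdOn j (fun ζ : Ω => f (z, ζ)) z)

end Spaces

end TwoBox

end

noncomputable section

open Filter Topology

namespace TwoBox

/-! ### Unitary equivalence with the space of a kernel -/

section Kernel

variable {X V S : Type*} [NormedAddCommGroup V] [InnerProductSpace ℂ V] [CompleteSpace V]

/-! Write `k_z` for the kernel vectors of either factor. They depend weakly differentiably on `z`,
so differentiation at a point of `Ω` is represented by vectors `a_{z,j}` in `(H, K^α)` and `b_{z,j}`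
in `(H, K^β)`, whose inner products are derivatives of the kernels (`exists_derivative_vectors`).
Hence `F ↦ (R₁ F)(z)_j` is the inner product with `r_{z,j} = c (β a_{z,j} ⊗ k_z - α k_z ⊗ b_{z,j})`,
`c = (αβ(α+β))^{-1/2}`.

Three facts about these vectors carry the theorem. The weights `β, -α` cancel on the diagonal, so
`r_{z,j} ∈ A₀` (`R₁Vec_mem_A₀`). On `A₀` the chain rule gives `∂_j F = -∂_{m+j} F` along the
diagonal, so there `R₁` is a nonzero multiple of `(∂_{m+j} F)_j`; thus the `r_{z,j}` lie in `S₁` and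
separate its points (`R₁Vec_mem_S₁`, `eq_zero_of_mem_S₁`). Their Gram matrix is the curvature kernel
(`inner_R₁Vec_R₁Vec`). A Hilbert space with a separating family of evaluations is the space of its
Gram kernel (`exists_linearIsometryEquiv_ofKernel`), which yields positivity and the unitary
together.

For `F ∈ A₀` the product rule on the diagonal has only one surviving term, so `R₁ (p F) = (p ∘ ι) R₁
F`; projecting to `S₁` changes nothing, as `r_{z,j} ∈ S₁`. The module laws on `S₁` and the
boundedness of multiplication on the target are then transported through the unitary. -/

theorem denseRange_linearCombination_kerFun (H : Type*) [NormedAddCommGroup H]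
    [InnerProductSpace ℂ H] [CompleteSpace H] [RKHS ℂ H X V] :
    DenseRange (Finsupp.linearCombination ℂ fun p : X × V => RKHS.kerFun H p.1 p.2) := by
  have h := RKHS.kerFun_dense (𝕜 := ℂ) H
  rw [← Submodule.dense_iff_topologicalClosure_eq_top] at h
  have hr : Set.range (fun p : X × V => RKHS.kerFun H p.1 p.2)
      = {RKHS.kerFun H x v | (x) (v)} := by
    ext f
    simp
  rw [← hr, ← Finsupp.range_linearCombination] at h
  exact h

/-- Two reproducing kernel Hilbert spaces with the same kernel consist of the same functions. -/
theorem exists_linearIsometryEquiv_of_kernel_eq {H₁ H₂ : Type*}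
    [NormedAddCommGroup H₁] [InnerProductSpace ℂ H₁] [CompleteSpace H₁] [RKHS ℂ H₁ X V]
    [NormedAddCommGroup H₂] [InnerProductSpace ℂ H₂] [CompleteSpace H₂] [RKHS ℂ H₂ X V]
    (h : RKHS.kernel H₁ = RKHS.kernel H₂) :
    ∃ U : H₁ ≃ₗᵢ[ℂ] H₂, ∀ (f : H₁) (x : X), U f x = f x := by
  let T₁ := Finsupp.linearCombination ℂ fun p : X × V => RKHS.kerFun H₁ p.1 p.2
  let T₂ := Finsupp.linearCombination ℂ fun p : X × V => RKHS.kerFun H₂ p.1 p.2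
  -- Inner products of kernel functions are kernel values, so matching them up is isometric on dense
  -- subspaces.
  have hin : ∀ c d, ⟪T₁ c, T₁ d⟫_ℂ = ⟪T₂ c, T₂ d⟫_ℂ := by
    intro c d
    simp only [T₁, T₂, Finsupp.linearCombination_apply, Finsupp.sum_inner, Finsupp.inner_sum,
      inner_smul_left, inner_smul_right, ← RKHS.kernel_inner, h]
  have hnorm : ∀ c, ‖T₂ (LinearEquiv.refl ℂ _ c)‖ = ‖T₁ c‖ := by
    intro c
    rw [LinearEquiv.refl_apply, @norm_eq_sqrt_re_inner ℂ, @norm_eq_sqrt_re_inner ℂ _ _ _ _ (T₁ c),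
      hin]
  let U : H₁ ≃ₗᵢ[ℂ] H₂ := (LinearEquiv.refl ℂ (X × V →₀ ℂ)).extendOfIsometry T₁ T₂
    (denseRange_linearCombination_kerFun H₁) (denseRange_linearCombination_kerFun H₂) hnorm
  have hU : ∀ c, U (T₁ c) = T₂ c := fun c => LinearEquiv.extendOfIsometry_eq _ _ _ _ _ _ _
  refine ⟨U, fun f x => ext_inner_left ℂ fun v => ?_⟩
  have hk : U (RKHS.kerFun H₁ x v) = RKHS.kerFun H₂ x v := by
    simpa [T₁, T₂] using hU (Finsupp.single (x, v) 1)
  rw [← RKHS.kerFun_inner, ← hk, U.inner_map_map, RKHS.kerFun_inner]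

/-- A Hilbert space with a separating family of operators `ev x` into `V` is unitarily equivalent
to the reproducing kernel Hilbert space of the kernel `(x, y) ↦ ev x ∘ (ev y)†`. -/
theorem exists_linearIsometryEquiv_ofKernel [NormedAddCommGroup S] [InnerProductSpace ℂ S]
    [CompleteSpace S] (ev : X → S →L[ℂ] V) (hev : ∀ f, (∀ x, ev x f = 0) → f = 0)
    (G : Matrix X X (V →L[ℂ] V)) (hG : ∀ x y, ev x ∘L (ev y).adjoint = G x y) :
    ∃ (_ : Fact G.PosSemidef) (U : S ≃ₗᵢ[ℂ] RKHS.OfKernel G), ∀ f x, U f x = ev x f := by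
  let _ : RKHS ℂ S X V :=
    { coeCLM := ContinuousLinearMap.pi ev
      coeCLM_injective := (injective_iff_map_eq_zero _).mpr fun f hf =>
        hev f fun x => congrFun hf x }
  have hfun : ∀ (f : S) (x : X), f x = ev x f := fun f x => rfl
  have hker : RKHS.kernel S = G := by
    ext x y v
    rw [← RKHS.kerFun_apply, hfun, ← hG]
    rfl
  have hpos : Fact G.PosSemidef := ⟨hker ▸ RKHS.posSemidef_kernel S⟩
  obtain ⟨U, hU⟩ := exists_linearIsometryEquiv_of_kernel_eq (H₁ := S) (H₂ := RKHS.OfKernel G)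
    (by rw [hker, RKHS.OfKernel.kernel_ofKernel])
  exact ⟨hpos, U, hU⟩

end Kernel

/-! ### Multiplication by polynomials -/

section Multiplication

variable {σ X V H : Type*} [NormedAddCommGroup V] [InnerProductSpace ℂ V]
    [NormedAddCommGroup H] [InnerProductSpace ℂ H] [RKHS ℂ H X V]

/-- Elements of `H` are determined by their values, so the algebra laws need only be checked
pointwise. -/
theorem exists_isMultiplicationModule_of_forall (c : X → σ → ℂ)
    (h : ∀ p : MvPolynomial σ ℂ, ∃ T : H →L[ℂ] H, ∀ f x, T f x = MvPolynomial.eval (c x) p • f x) :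
    ∃ ρ : HilbertModule (MvPolynomial σ ℂ) H, IsMultiplicationModule c ρ := by
  choose T hT using h
  refine ⟨AlgHom.ofLinearMap ⟨⟨T, fun p q => ?_⟩, fun a p => ?_⟩ ?_ fun p q => ?_, hT⟩
  · ext f x
    simp [hT, add_smul]
  · ext f x
    simp [hT, mul_smul, MvPolynomial.smul_eval]
  · ext f x
    simp [hT]
  · ext f x
    simp [hT, mul_smul]

/-- If the coordinates multiply `H` boundedly, then `H` is a Hilbert module over the
polynomials. -/
theorem exists_isMultiplicationModule (c : X → σ → ℂ)
    (h : ∀ i, ∃ T : H →L[ℂ] H, ∀ f x, T f x = c x i • f x) :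
    ∃ ρ : HilbertModule (MvPolynomial σ ℂ) H, IsMultiplicationModule c ρ := by
  refine exists_isMultiplicationModule_of_forall c fun p => ?_
  induction p using MvPolynomial.induction_on with
  | C a => exact ⟨a • ContinuousLinearMap.id ℂ H, fun f x => by simp⟩
  | add p q hp hq =>
    obtain ⟨S, hS⟩ := hp
    obtain ⟨T, hT⟩ := hq
    exact ⟨S + T, fun f x => by simp [hS, hT, add_smul]⟩
  | mul_X p i hp =>
    obtain ⟨S, hS⟩ := hp
    obtain ⟨T, hT⟩ := h i
    exact ⟨S ∘L T, fun f x => by simp [hS, hT, mul_smul]⟩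

end Multiplication

/-! ### Elementary tensors -/

section Tensor

variable {X Y H₁ H₂ : Type*} [NormedAddCommGroup H₁] [InnerProductSpace ℂ H₁]
  [NormedAddCommGroup H₂] [InnerProductSpace ℂ H₂]

/-- The elementary tensor `a ⊗ b` in the Hilbert space tensor product, as a bounded bilinear
map. -/
def tmulL : H₁ →L[ℂ] H₂ →L[ℂ] HilbertTensor H₁ H₂ :=
  (ContinuousLinearMap.compL ℂ H₂ (H₁ ⊗[ℂ] H₂) (HilbertTensor H₁ H₂)
    UniformSpace.Completion.toComplL).comp (TensorProduct.mkL ℂ H₁ H₂)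

theorem tmulL_apply (a : H₁) (b : H₂) :
    tmulL a b = ((a ⊗ₜ[ℂ] b : H₁ ⊗[ℂ] H₂) : HilbertTensor H₁ H₂) := rfl

theorem inner_tmulL (a c : H₁) (b d : H₂) :
    ⟪tmulL a b, tmulL c d⟫_ℂ = ⟪a, c⟫_ℂ * ⟪b, d⟫_ℂ := by
  simp [tmulL_apply]

theorem norm_tmulL (a : H₁) (b : H₂) : ‖tmulL a b‖ = ‖a‖ * ‖b‖ := by
  simp [tmulL_apply]

/-- Slicing `F` by the adjoint of `a ↦ a ⊗ b`; this carries weak derivatives from a factor to the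
tensor product. -/
theorem exists_inner_tmulL_left [CompleteSpace H₁] (b : H₂) (F : HilbertTensor H₁ H₂) :
    ∃ g : H₁, ∀ a, ⟪tmulL a b, F⟫_ℂ = ⟪a, g⟫_ℂ :=
  ⟨(tmulL.flip b).adjoint F, fun a => by
    rw [ContinuousLinearMap.adjoint_inner_right, ContinuousLinearMap.flip_apply]⟩

theorem exists_inner_tmulL_right [CompleteSpace H₂] (a : H₁) (F : HilbertTensor H₁ H₂) :
    ∃ g : H₂, ∀ b, ⟪tmulL a b, F⟫_ℂ = ⟪b, g⟫_ℂ :=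
  ⟨(tmulL a).adjoint F, fun b => by rw [ContinuousLinearMap.adjoint_inner_right]⟩

/-- The functorial action of the Hilbert space tensor product on bounded operators. -/
def mapTensor (S : H₁ →L[ℂ] H₁) (T : H₂ →L[ℂ] H₂) :
    HilbertTensor H₁ H₂ →L[ℂ] HilbertTensor H₁ H₂ :=
  (TensorProduct.mapL S T).completion

theorem mapTensor_tmulL (S : H₁ →L[ℂ] H₁) (T : H₂ →L[ℂ] H₂) (a : H₁) (b : H₂) :
    mapTensor S T (tmulL a b) = tmulL (S a) (T b) := by
  simp [mapTensor, tmulL_apply, TensorProduct.mapL_apply]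

theorem eq_of_forall_tmulL {E : Type*} [NormedAddCommGroup E] [NormedSpace ℂ E]
    {S T : HilbertTensor H₁ H₂ →L[ℂ] E} (h : ∀ a b, S (tmulL a b) = T (tmulL a b)) : S = T := by
  refine ContinuousLinearMap.ext fun F => ?_
  refine UniformSpace.Completion.induction_on F (isClosed_eq S.continuous T.continuous) fun t => ?_
  induction t using TensorProduct.induction_on with
  | zero => simp [UniformSpace.Completion.coe_zero]
  | tmul a b => exact h a b
  | add s t hs ht => rw [UniformSpace.Completion.coe_add, map_add, map_add, hs, ht]

variable [CompleteSpace H₁] [CompleteSpace H₂] [RKHS ℂ H₁ X ℂ] [RKHS ℂ H₂ Y ℂ]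

theorem hilbertTensor_apply (F : HilbertTensor H₁ H₂) (p : X × Y) :
    F p = ⟪tmulL (RKHS.kerFun H₁ p.1 1) (RKHS.kerFun H₂ p.2 1), F⟫_ℂ := rfl

/-- Multipliers of the factors induce multipliers of the tensor product. -/
theorem mapTensor_apply {S : H₁ →L[ℂ] H₁} {T : H₂ →L[ℂ] H₂} {φ : X → ℂ} {ψ : Y → ℂ}
    (hS : ∀ f x, S f x = φ x • f x) (hT : ∀ g y, T g y = ψ y • g y)
    (F : HilbertTensor H₁ H₂) (p : X × Y) : mapTensor S T F p = (φ p.1 * ψ p.2) • F p := by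
  let e : HilbertTensor H₁ H₂ →L[ℂ] ℂ := (ContinuousLinearMap.proj p).comp (RKHS.coeCLM ℂ)
  have he : ∀ F, e F = F p := fun F => rfl
  have : e.comp (mapTensor S T) = (φ p.1 * ψ p.2) • e := by
    refine eq_of_forall_tmulL fun a b => ?_
    simp only [ContinuousLinearMap.comp_apply, smul_apply, he, mapTensor_tmulL]
    simp only [tmulL_apply, tensor_apply_tmul, hS, hT, smul_eq_mul]
    ring
  exact DFunLike.congr_fun this F

end Tensor

/-! ### Weakly holomorphic curves in Hilbert spaces -/

section Curves

variable {H : Type*} [NormedAddCommGroup H] [InnerProductSpace ℂ H]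

/-- With `γ` bounded on `D`, norm convergence of `f` gives uniform convergence of `⟪γ t, f⟫`, and
uniform limits of holomorphic functions are holomorphic. So the admissible `f` form a closed
subspace. -/
theorem differentiableOn_inner_of_dense {D : Set ℂ} (hD : IsOpen D) {γ : ℂ → H} {C : ℝ}
    (hC : ∀ t ∈ D, ‖γ t‖ ≤ C) {s : Set H} (hs : (Submodule.span ℂ s).topologicalClosure = ⊤)
    (h : ∀ f ∈ s, DifferentiableOn ℂ (fun t => ⟪γ t, f⟫_ℂ) D) (f : H) :
    DifferentiableOn ℂ (fun t => ⟪γ t, f⟫_ℂ) D := by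
  let M : Submodule ℂ H :=
    { carrier := {f | DifferentiableOn ℂ (fun t => ⟪γ t, f⟫_ℂ) D}
      add_mem' := fun {f g} hf hg => by
        simpa only [Set.mem_ofPred_eq, inner_add_right] using DifferentiableOn.fun_add hf hg
      zero_mem' := by simp
      smul_mem' := fun c f hf => by
        simpa only [Set.mem_ofPred_eq, inner_smul_right] using DifferentiableOn.const_mul hf c }
  have hclosed : IsClosed (M : Set H) := by
    refine IsSeqClosed.isClosed fun u f hu hf => ?_
    have hunif : TendstoUniformlyOn (fun n t => ⟪γ t, u n⟫_ℂ) (fun t => ⟪γ t, f⟫_ℂ) atTop D := by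
      rw [Metric.tendstoUniformlyOn_iff]
      intro ε hε
      have hlim : Tendsto (fun n => C * ‖f - u n‖) atTop (𝓝 0) := by
        have := (tendsto_const_nhds (x := f)).sub hf
        simpa using this.norm.const_mul C
      filter_upwards [hlim.eventually (gt_mem_nhds hε)] with n hn t ht
      rw [dist_eq_norm, ← inner_sub_right]
      refine (norm_inner_le_norm _ _).trans_lt (lt_of_le_of_lt ?_ hn)
      gcongr
      exact hC t ht
    exact hunif.tendstoLocallyUniformlyOn.differentiableOn (Eventually.of_forall hu) hD
  have hle := Submodule.topologicalClosure_minimal (t := M) (Submodule.span ℂ s)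
    (Submodule.span_le.mpr h) hclosed
  rw [hs] at hle
  exact hle Submodule.mem_top

/-- A sequence of steps suffices below, and convergent sequences are bounded at every index, as
Banach–Steinhaus requires. -/
theorem tendsto_one_div_nhdsNE :
    Tendsto (fun n : ℕ => (1 / ((n : ℂ) + 1))) atTop (𝓝[≠] 0) := by
  refine tendsto_nhdsWithin_iff.mpr ⟨tendsto_one_div_add_atTop_nhds_zero_nat, ?_⟩
  exact Eventually.of_forall fun n => one_div_ne_zero (Nat.cast_add_one_ne_zero n)

/-- A weak derivative of a curve `γ`: as the inner product is conjugate linear in `γ`, the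
functions `t ↦ ⟪γ t, f⟫` are required to be holomorphic at `0`. -/
def HasWeakDerivAt (γ : ℂ → H) (d : H) : Prop :=
  ∀ f, HasDerivAt (fun t => ⟪γ t, f⟫_ℂ) ⟪d, f⟫_ℂ 0

/-- The difference quotients are bounded functionals converging pointwise, so the limit is bounded
by Banach–Steinhaus and is represented by a vector by Riesz. -/
theorem exists_hasWeakDerivAt [CompleteSpace H] {γ : ℂ → H}
    (h : ∀ f, DifferentiableAt ℂ (fun t => ⟪γ t, f⟫_ℂ) 0) : ∃ d, HasWeakDerivAt γ d := by
  let g : ℕ → H →L[ℂ] ℂ := fun n =>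
    (1 / ((n : ℂ) + 1))⁻¹ • (innerSL ℂ (γ (1 / ((n : ℂ) + 1))) - innerSL ℂ (γ 0))
  have hg : Tendsto (fun n f => g n f) atTop (𝓝 fun f => deriv (fun t => ⟪γ t, f⟫_ℂ) 0) := by
    refine tendsto_pi_nhds.mpr fun f => ?_
    have := (hasDerivAt_iff_tendsto_slope_zero.mp (h f).hasDerivAt).comp tendsto_one_div_nhdsNE
    simpa [g, Function.comp_def] using this
  let φ : H →L[ℂ] ℂ := continuousLinearMapOfTendsto g hg
  refine ⟨(InnerProductSpace.toDual ℂ H).symm φ, fun f => ?_⟩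
  rw [InnerProductSpace.toDual_symm_apply]
  exact (h f).hasDerivAt

/-- Weakly convergent difference quotients are bounded in norm. This replaces strong
differentiability in the product rule. -/
theorem HasWeakDerivAt.exists_norm_sub_le [CompleteSpace H] {γ : ℂ → H} {d : H}
    (h : HasWeakDerivAt γ d) :
    ∃ C, ∀ n : ℕ, ‖γ (1 / ((n : ℂ) + 1)) - γ 0‖ ≤ C * ‖1 / ((n : ℂ) + 1)‖ := by
  let g : ℕ → H →L[ℂ] ℂ := fun n =>
    (1 / ((n : ℂ) + 1))⁻¹ • innerSL ℂ (γ (1 / ((n : ℂ) + 1)) - γ 0)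
  obtain ⟨C, hC⟩ := banach_steinhaus (g := g) fun f => by
    have := (hasDerivAt_iff_tendsto_slope_zero.mp (h f)).comp tendsto_one_div_nhdsNE
    obtain ⟨C, hC⟩ := (Metric.isBounded_range_of_tendsto _ this).exists_norm_le
    refine ⟨C, fun n => ?_⟩
    have := hC _ ⟨n, rfl⟩
    simpa [g, Function.comp_def, inner_sub_left] using this
  refine ⟨C, fun n => ?_⟩
  have hn : ‖1 / ((n : ℂ) + 1)‖ ≠ 0 := norm_ne_zero_iff.mpr
    (one_div_ne_zero (Nat.cast_add_one_ne_zero n))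
  have := hC n
  rw [norm_smul, norm_inv, innerSL_apply_norm, inv_mul_le_iff₀ (by positivity)] at this
  linarith

variable {H₁ H₂ : Type*} [NormedAddCommGroup H₁] [InnerProductSpace ℂ H₁]
  [NormedAddCommGroup H₂] [InnerProductSpace ℂ H₂]

theorem HasWeakDerivAt.tmulL_left [CompleteSpace H₁] {γ : ℂ → H₁} {d : H₁}
    (h : HasWeakDerivAt γ d) (b : H₂) :
    HasWeakDerivAt (fun t => tmulL (γ t) b) (tmulL d b) := fun F => by
  obtain ⟨g, hg⟩ := exists_inner_tmulL_left b F
  simpa only [hg] using h g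

theorem HasWeakDerivAt.tmulL_right [CompleteSpace H₂] {δ : ℂ → H₂} {d : H₂}
    (h : HasWeakDerivAt δ d) (a : H₁) :
    HasWeakDerivAt (fun t => tmulL a (δ t)) (tmulL a d) := fun F => by
  obtain ⟨g, hg⟩ := exists_inner_tmulL_right a F
  simpa only [hg] using h g

/-- The product rule for a vector that is orthogonal to the curve `γ ⊗ δ`. -/
theorem HasWeakDerivAt.inner_tmulL_add_eq_zero [CompleteSpace H₁] [CompleteSpace H₂]
    {γ : ℂ → H₁} {δ : ℂ → H₂} {d : H₁} {e : H₂}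
    (hγ : HasWeakDerivAt γ d) (hδ : HasWeakDerivAt δ e) {F : HilbertTensor H₁ H₂}
    (hF : ∀ᶠ t in 𝓝 0, ⟪tmulL (γ t) (δ t), F⟫_ℂ = 0) :
    ⟪tmulL d (δ 0), F⟫_ℂ + ⟪tmulL (γ 0) e, F⟫_ℂ = 0 := by
  obtain ⟨C, hC⟩ := hγ.exists_norm_sub_le
  obtain ⟨D, hD⟩ := hδ.exists_norm_sub_le
  have hC0 : 0 ≤ C := by simpa using (norm_nonneg _).trans (hC 0)
  have h₁ := (hasDerivAt_iff_tendsto_slope_zero.mp (hγ.tmulL_left (δ 0) F)).comp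
    tendsto_one_div_nhdsNE
  have h₂ := (hasDerivAt_iff_tendsto_slope_zero.mp (hδ.tmulL_right (γ 0) F)).comp
    tendsto_one_div_nhdsNE
  have hlim := (h₁.add h₂).norm
  have h0 : Tendsto (fun n : ℕ => C * D * ‖F‖ * ‖1 / ((n : ℂ) + 1)‖) atTop (𝓝 0) := by
    have : Tendsto (fun n : ℕ => 1 / ((n : ℂ) + 1)) atTop (𝓝 0) :=
      tendsto_one_div_nhdsNE.mono_right nhdsWithin_le_nhds
    simpa using this.norm.const_mul (C * D * ‖F‖)
  rw [← norm_le_zero_iff]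
  refine le_of_tendsto_of_tendsto hlim h0 ?_
  filter_upwards [(tendsto_one_div_nhdsNE.mono_right nhdsWithin_le_nhds).eventually hF] with n hn
  set t : ℂ := 1 / ((n : ℂ) + 1) with ht
  have ht0 : t ≠ 0 := one_div_ne_zero (Nat.cast_add_one_ne_zero n)
  have hF0 := hF.self_of_nhds
  -- Since `F` is orthogonal to `γ ⊗ δ` at `t` and at `0`, the two slopes add up to minus the mixed
  -- second difference over `t`, which is `O(|t|)`.
  have key : t⁻¹ • (⟪tmulL (γ t) (δ 0), F⟫_ℂ - ⟪tmulL (γ 0) (δ 0), F⟫_ℂ)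
      + t⁻¹ • (⟪tmulL (γ 0) (δ t), F⟫_ℂ - ⟪tmulL (γ 0) (δ 0), F⟫_ℂ)
      = -(t⁻¹ • ⟪tmulL (γ t - γ 0) (δ t - δ 0), F⟫_ℂ) := by
    simp only [map_sub, sub_apply, inner_sub_left, hn, hF0, smul_eq_mul]
    ring
  simp only [Function.comp_apply, zero_add]
  rw [key, norm_neg, norm_smul, norm_inv, inv_mul_le_iff₀ (norm_pos_iff.mpr ht0)]
  calc ‖⟪tmulL (γ t - γ 0) (δ t - δ 0), F⟫_ℂ‖
      ≤ ‖γ t - γ 0‖ * ‖δ t - δ 0‖ * ‖F‖ := by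
        rw [← norm_tmulL]
        exact norm_inner_le_norm _ _
    _ ≤ (C * ‖t‖) * (D * ‖t‖) * ‖F‖ := by
        have := hC n
        have := hD n
        gcongr
    _ = ‖t‖ * (C * D * ‖F‖ * ‖t‖) := by ring

end Curves

/-! ### Reproducing kernel Hilbert spaces of holomorphic functions -/

section Scalar

variable {m : ℕ} {Ω : Set (Fin m → ℂ)} (H : Type*) [NormedAddCommGroup H]
  [InnerProductSpace ℂ H] [CompleteSpace H] [RKHS ℂ H Ω ℂ]

/-- The kernel vectors of a scalar reproducing kernel Hilbert space on `Ω`, extended by zero. -/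
def kerVec (x : Fin m → ℂ) : H :=
  Function.extend Subtype.val (fun z : Ω => RKHS.kerFun H z 1) 0 x

variable {H}

theorem kerVec_coe (z : Ω) : kerVec H (z : Fin m → ℂ) = RKHS.kerFun H z 1 :=
  Subtype.val_injective.extend_apply _ _ z

theorem kerVec_of_notMem {x : Fin m → ℂ} (hx : x ∉ Ω) : kerVec H x = 0 :=
  Function.extend_apply' _ _ _ (by rintro ⟨z, rfl⟩; exact hx z.2)

theorem inner_kerVec_coe (z : Ω) (f : H) : ⟪kerVec H (z : Fin m → ℂ), f⟫_ℂ = f z := by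
  simp [kerVec_coe]

theorem eventually_add_smul_mem {Ω : Set (Fin m → ℂ)} (hΩ : IsOpen Ω) {z : Fin m → ℂ}
    (hz : z ∈ Ω) (v : Fin m → ℂ) : ∀ᶠ t : ℂ in 𝓝 0, z + t • v ∈ Ω := by
  have hc : Continuous fun t : ℂ => z + t • v := by fun_prop
  exact hc.continuousAt.eventually (hΩ.mem_nhds (by simpa using hz))

/-- If the kernel functions are locally bounded in norm and holomorphic along a direction, then so
are all elements of the space. -/
theorem exists_hasWeakDerivAt_kerVec (hΩ : IsOpen Ω) {v : Fin m → ℂ}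
    (hker : ∀ w z : Ω, DifferentiableAt ℂ
      (fun t : ℂ => ⟪kerVec H ((z : Fin m → ℂ) + t • v), kerVec H w⟫_ℂ) 0)
    (hbdd : ∀ z : Ω, ∃ C, ∀ᶠ x in 𝓝 (z : Fin m → ℂ), ‖kerVec H x‖ ≤ C) (z : Ω) :
    ∃ d, HasWeakDerivAt (fun t : ℂ => kerVec H ((z : Fin m → ℂ) + t • v)) d := by
  obtain ⟨C, hC⟩ := hbdd z
  have hc : Continuous fun t : ℂ => (z : Fin m → ℂ) + t • v := by fun_prop
  have hnear : ∀ᶠ t : ℂ in 𝓝 0, ‖kerVec H ((z : Fin m → ℂ) + t • v)‖ ≤ C :=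
    (hc.tendsto' 0 _ (by simp)).eventually hC
  obtain ⟨D, hD, hDo, h0⟩ := eventually_nhds_iff.mp
    (hnear.and (eventually_add_smul_mem hΩ z.2 v))
  refine exists_hasWeakDerivAt fun f => ?_
  refine (differentiableOn_inner_of_dense hDo (fun t ht => (hD t ht).1) (RKHS.kerFun_dense H)
    ?_ f).differentiableAt (hDo.mem_nhds h0)
  rintro _ ⟨w, c, rfl⟩ t ht
  have hk : RKHS.kerFun H w c = c • kerVec H (w : Fin m → ℂ) := by
    rw [kerVec_coe, ← map_smul, smul_eq_mul, mul_one]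
  simp only [hk, inner_smul_right]
  refine (DifferentiableAt.const_mul ?_ c).differentiableWithinAt
  -- `hker` speaks of parameter `0` only; apply it at the base point `z + t • v` and translate.
  have h1 := hker w ⟨_, (hD t ht).2⟩
  have h2 : DifferentiableAt ℂ (fun s : ℂ => s - t) t := by fun_prop
  rw [← sub_self t] at h1
  have h3 := DifferentiableAt.comp t (f := fun s => s - t) h1 h2
  refine h3.congr_of_eventuallyEq (Eventually.of_forall fun s => ?_)
  simp only [Function.comp_apply]
  congr 2
  rw [add_assoc, ← add_smul]
  simp

end Scalar

/-! ### The logarithm of the kernel -/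

section Log

variable {m : ℕ} {Ω : Set (Fin m → ℂ)} {K L : (Fin m → ℂ) → (Fin m → ℂ) → ℂ}

/-- `L` is only assumed continuous. Near `w` its imaginary part moves by less than `π`, so `L` is `L
z w` plus the principal logarithm of a quotient of values of `K`. -/
theorem differentiableAt_conj_log (hΩ : IsOpen Ω) (hK : IsSesquiAnalytic Ω K)
    (hL : IsLogBranch Ω K L) {z w : Fin m → ℂ} (hz : z ∈ Ω) (hw : w ∈ Ω) (j : Fin m) :
    DifferentiableAt ℂ (fun t : ℂ => conj (L z (w + t • Pi.single j 1))) 0 := by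
  let c : ℂ → (Fin m → ℂ) := fun t => w + conj t • Pi.single j 1
  have hc : Continuous c := by
    have : Continuous fun t : ℂ => conj t := Complex.continuous_conj
    fun_prop
  have hc0 : c 0 = w := by simp [c]
  have hcΩ : ∀ᶠ t in 𝓝 0, c t ∈ Ω := hc.continuousAt.eventually (hΩ.mem_nhds (by rwa [hc0]))
  have hk : DifferentiableAt ℂ (fun t => K z (c t)) 0 := by
    let W : Set ((Fin m → ℂ) × (Fin m → ℂ)) := {p | p.1 ∈ Ω ∧ star p.2 ∈ Ω}
    have hW : IsOpen W :=
      (hΩ.preimage continuous_fst).inter (hΩ.preimage (continuous_star.comp continuous_snd))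
    have h1 := (hK (z, star w) ⟨hz, by simpa using hw⟩).differentiableAt
      (hW.mem_nhds ⟨hz, by simpa using hw⟩)
    have h2 : DifferentiableAt ℂ
        (fun t : ℂ => (z, star w + t • (Pi.single j 1 : Fin m → ℂ))) 0 := by fun_prop
    have h3 := DifferentiableAt.comp (0 : ℂ)
      (g := fun p : (Fin m → ℂ) × (Fin m → ℂ) => K p.1 (star p.2)) (by simpa using h1) h2
    refine h3.congr_of_eventuallyEq (Eventually.of_forall fun t => ?_)
    simp [c]
  have hl : ContinuousAt (fun t => L z (c t)) 0 := by
    have h1 := hL.1.continuousAt (x := (z, w)) ((hΩ.prod hΩ).mem_nhds ⟨hz, hw⟩)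
    have h2 : ContinuousAt (fun t => (z, c t)) 0 := by fun_prop
    exact ContinuousAt.comp (g := fun p : (Fin m → ℂ) × (Fin m → ℂ) => L p.1 p.2)
      (by rwa [hc0]) h2
  have hK0 : K z w ≠ 0 := by
    rw [← hL.2 z hz w hw]
    exact Complex.exp_ne_zero _
  have hg : DifferentiableAt ℂ (fun t => L z (c t)) 0 := by
    have hlog : DifferentiableAt ℂ
        (fun t => L z w + Complex.log (K z (c t) / K z w)) 0 := by
      refine (DifferentiableAt.clog (hk.div_const _) ?_).const_add _
      simp [hc0, hK0]
    refine hlog.congr_of_eventuallyEq ?_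
    have him : ContinuousAt (fun t => (L z (c t) - L z w).im) 0 :=
      Complex.continuous_im.continuousAt.comp (hl.sub continuousAt_const)
    have hpi : ∀ᶠ t in 𝓝 0, |(L z (c t) - L z w).im| < Real.pi := by
      refine him.abs.eventually (gt_mem_nhds ?_)
      simpa [hc0] using Real.pi_pos
    filter_upwards [hpi, hcΩ] with t ht htΩ
    rw [← hL.2 z hz _ htΩ, ← hL.2 z hz w hw, ← Complex.exp_sub,
      Complex.log_exp (abs_lt.mp ht).1 (abs_lt.mp ht).2.le]
    ring
  have := (show DifferentiableAt ℂ (fun t => L z (c t)) (conj 0) by simpa using hg).conj_conj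
  simpa [c, Function.comp_def] using this

theorem hasDerivAt_conj_log (hΩ : IsOpen Ω) (hK : IsSesquiAnalytic Ω K)
    (hL : IsLogBranch Ω K L) {z w : Fin m → ℂ} (hz : z ∈ Ω) (hw : w ∈ Ω) (j : Fin m) :
    HasDerivAt (fun t : ℂ => conj (L z (w + t • Pi.single j 1)))
      (conj (pdbar j (fun w' => L z w') w)) 0 := by
  have := (differentiableAt_conj_log hΩ hK hL hz hw j).hasDerivAt
  simpa [pdbar, pd, lineDeriv] using this

end Log

/-! ### The spaces of the powers of the kernel -/

section Power

variable {m : ℕ} {Ω : Set (Fin m → ℂ)} {K L : (Fin m → ℂ) → (Fin m → ℂ) → ℂ} {t : ℝ}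
  [Fact (powKernel Ω L t).PosSemidef]

theorem inner_kerVec_kerVec {z w : Fin m → ℂ} (hz : z ∈ Ω) (hw : w ∈ Ω) :
    ⟪kerVec (PowSpace Ω L t) z, kerVec (PowSpace Ω L t) w⟫_ℂ = kpow L t z w := by
  lift z to Ω using hz
  lift w to Ω using hw
  rw [inner_kerVec_coe, kerVec_coe, RKHS.kerFun_apply, RKHS.OfKernel.kernel_ofKernel]
  simp [powKernel]

-- Positivity gives Hermitian symmetry of the power; none is claimed for the branch `L`.
variable (t) in
theorem kpow_eq_conj {z w : Fin m → ℂ} (hz : z ∈ Ω) (hw : w ∈ Ω) :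
    kpow L t z w = conj (kpow L t w z) := by
  rw [← inner_kerVec_kerVec hz hw, ← inner_kerVec_kerVec hw hz, inner_conj_symm]

theorem kpow_ne_zero (z w : Fin m → ℂ) : kpow L t z w ≠ 0 := Complex.exp_ne_zero _

/-- Hermitian symmetry turns the derivative in the first variable into the conjugate of an
antiholomorphic one in the second. -/
theorem hasDerivAt_kpow (hΩ : IsOpen Ω) (hK : IsSesquiAnalytic Ω K) (hL : IsLogBranch Ω K L)
    {z w : Fin m → ℂ} (hz : z ∈ Ω) (hw : w ∈ Ω) (i : Fin m) :
    HasDerivAt (fun s : ℂ => ⟪kerVec (PowSpace Ω L t) (w + s • Pi.single i 1),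
      kerVec (PowSpace Ω L t) z⟫_ℂ) (t * conj (pdbar i (fun w' => L z w') w) * kpow L t w z) 0 := by
  have h := ((hasDerivAt_conj_log hΩ hK hL hz hw i).const_mul (t : ℂ)).cexp
  have hval : Complex.exp (t * conj (L z (w + (0 : ℂ) • Pi.single i 1)))
      * (t * conj (pdbar i (fun w' => L z w') w))
      = t * conj (pdbar i (fun w' => L z w') w) * kpow L t w z := by
    rw [kpow_eq_conj t hw hz]
    simp only [kpow, zero_smul, add_zero, ← Complex.exp_conj, map_mul, Complex.conj_ofReal]
    ring
  rw [hval] at h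
  refine h.congr_of_eventuallyEq ?_
  filter_upwards [eventually_add_smul_mem hΩ hw (Pi.single i 1)] with s hs
  rw [inner_kerVec_kerVec hs hz, kpow_eq_conj t hs hz]
  simp only [kpow, ← Complex.exp_conj, map_mul, Complex.conj_ofReal]

/-- The squared norm is `K ^ t` on the diagonal, which is continuous. -/
theorem eventually_norm_kerVec_le (hΩ : IsOpen Ω) (hL : IsLogBranch Ω K L) (z : Ω) :
    ∃ C, ∀ᶠ x in 𝓝 (z : Fin m → ℂ), ‖kerVec (PowSpace Ω L t) x‖ ≤ C := by
  have h1 := hL.1.continuousAt (x := ((z : Fin m → ℂ), (z : Fin m → ℂ)))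
    ((hΩ.prod hΩ).mem_nhds ⟨z.2, z.2⟩)
  have h2 : ContinuousAt (fun x : Fin m → ℂ => (x, x)) (z : Fin m → ℂ) := by fun_prop
  have h3 : ContinuousAt (fun x => L x x) (z : Fin m → ℂ) :=
    ContinuousAt.comp (g := fun p : (Fin m → ℂ) × (Fin m → ℂ) => L p.1 p.2)
      (f := fun x => (x, x)) h1 h2
  have h4 : ContinuousAt (fun x => Real.sqrt ‖kpow L t x x‖) (z : Fin m → ℂ) := by
    unfold kpow
    fun_prop
  refine ⟨Real.sqrt ‖kpow L t z z‖ + 1, ?_⟩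
  filter_upwards [h4.eventually (gt_mem_nhds (lt_add_one _)), hΩ.mem_nhds z.2] with x hx hxΩ
  refine le_trans (le_of_eq ?_) hx.le
  rw [← inner_kerVec_kerVec hxΩ hxΩ, inner_self_eq_norm_sq_to_K]
  simp

/-- The vectors representing the partial derivatives in the space of the kernel `K ^ t`, and their
inner products. -/
theorem exists_derivative_vectors (hΩ : IsOpen Ω) (hK : IsSesquiAnalytic Ω K)
    (hL : IsLogBranch Ω K L) (ht : t ≠ 0) :
    ∃ d : Ω → Fin m → PowSpace Ω L t,
      (∀ (z : Ω) j, HasWeakDerivAt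
        (fun s : ℂ => kerVec (PowSpace Ω L t) ((z : Fin m → ℂ) + s • Pi.single j 1)) (d z j)) ∧
      (∀ (w z : Ω) i, ⟪d w i, kerVec (PowSpace Ω L t) (z : Fin m → ℂ)⟫_ℂ
        = t * conj (pdbar i (fun w' => L z w') w) * kpow L t w z) ∧
      (∀ (w z : Ω) j, ⟪kerVec (PowSpace Ω L t) (w : Fin m → ℂ), d z j⟫_ℂ
        = t * pdbar j (fun w' => L w w') z * kpow L t w z) ∧
      (∀ (w z : Ω) i j, ⟪d w i, d z j⟫_ℂ
        = t * (pd i (fun z' => pdbar j (fun w' => L z' w') z) w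
          + t * pdbar j (fun w' => L w w') z * conj (pdbar i (fun w' => L z w') w))
          * kpow L t w z) := by
  have hex : ∀ (z : Ω) (j : Fin m), ∃ d, HasWeakDerivAt (fun s : ℂ =>
      kerVec (PowSpace Ω L t) ((z : Fin m → ℂ) + s • Pi.single j 1)) d := fun z j =>
    exists_hasWeakDerivAt_kerVec hΩ
      (fun w z => (hasDerivAt_kpow hΩ hK hL w.2 z.2 j).differentiableAt)
      (eventually_norm_kerVec_le hΩ hL) z
  choose d hd using hex
  have h1 : ∀ (w z : Ω) i, ⟪d w i, kerVec (PowSpace Ω L t) (z : Fin m → ℂ)⟫_ℂ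
      = t * conj (pdbar i (fun w' => L z w') w) * kpow L t w z := fun w z i =>
    (hd w i _).unique (hasDerivAt_kpow hΩ hK hL z.2 w.2 i)
  have h2 : ∀ (w z : Ω) j, ⟪kerVec (PowSpace Ω L t) (w : Fin m → ℂ), d z j⟫_ℂ
      = t * pdbar j (fun w' => L w w') z * kpow L t w z := by
    intro w z j
    rw [← inner_conj_symm, h1, map_mul, map_mul, Complex.conj_conj, Complex.conj_ofReal,
      ← kpow_eq_conj t w.2 z.2]
  refine ⟨d, hd, h1, h2, fun w z i j => ?_⟩
  have ht' : (t : ℂ) ≠ 0 := by exact_mod_cast ht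
  set k : ℂ → ℂ := fun s => ⟪kerVec (PowSpace Ω L t) ((w : Fin m → ℂ) + s • Pi.single i 1),
    kerVec (PowSpace Ω L t) (z : Fin m → ℂ)⟫_ℂ with hk
  set e : ℂ → ℂ := fun s => ⟪kerVec (PowSpace Ω L t) ((w : Fin m → ℂ) + s • Pi.single i 1),
    d z j⟫_ℂ with he
  set p : ℂ → ℂ := fun s => pdbar j (fun w' => L ((w : Fin m → ℂ) + s • Pi.single i 1) w') z
    with hp
  have hkd : HasDerivAt k (t * conj (pdbar i (fun w' => L z w') w) * kpow L t w z) 0 :=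
    hasDerivAt_kpow hΩ hK hL z.2 w.2 i
  have hed : HasDerivAt e ⟪d w i, d z j⟫_ℂ 0 := hd w i _
  have hkpow : ∀ᶠ s in 𝓝 0, k s = kpow L t ((w : Fin m → ℂ) + s • Pi.single i 1) z := by
    filter_upwards [eventually_add_smul_mem hΩ w.2 (Pi.single i 1)] with s hs
    exact inner_kerVec_kerVec hs z.2
  have hepk : e =ᶠ[𝓝 0] fun s => t * p s * k s := by
    filter_upwards [eventually_add_smul_mem hΩ w.2 (Pi.single i 1), hkpow] with s hs hks
    rw [hks]
    exact h2 ⟨_, hs⟩ z j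
  have hk0 : k 0 = kpow L t w z := by simpa using hkpow.self_of_nhds
  -- Differentiability of `∂̄_j log K` in the first variable comes from writing it as `e / (t k)`,
  -- both parts being inner products with a weakly differentiable curve; this is where `t ≠ 0`
  -- enters.
  have hpd : DifferentiableAt ℂ p 0 := by
    have hdiv : DifferentiableAt ℂ (fun s => e s / (t * k s)) 0 :=
      hed.differentiableAt.div (hkd.differentiableAt.const_mul _)
        (mul_ne_zero ht' (hk0 ▸ kpow_ne_zero _ _))
    refine hdiv.congr_of_eventuallyEq ?_
    filter_upwards [hepk, hkpow] with s hs hks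
    have : k s ≠ 0 := hks ▸ kpow_ne_zero _ _
    rw [hs]
    field_simp
  have hpd' : HasDerivAt p (pd i (fun z' => pdbar j (fun w' => L z' w') z) w) 0 := hpd.hasDerivAt
  have hp0 : p 0 = pdbar j (fun w' => L w w') z := by simp [hp]
  have := hed.unique (((hpd'.const_mul (t : ℂ)).mul hkd).congr_of_eventuallyEq hepk)
  rw [this, hk0, hp0]
  ring

end Power

/-! ### The subspace `S₁` and the map `R₁` -/

section Spaces

variable {m : ℕ} {Ω : Set (Fin m → ℂ)}

theorem S₁_le_A₀ {H : Type*} [NormedAddCommGroup H] [InnerProductSpace ℂ H]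
    [RKHS ℂ H (Ω × Ω) ℂ] : S₁ H ≤ A₀ H := inf_le_left

variable {H₁ H₂ : Type*} [NormedAddCommGroup H₁] [InnerProductSpace ℂ H₁] [CompleteSpace H₁]
  [NormedAddCommGroup H₂] [InnerProductSpace ℂ H₂] [CompleteSpace H₂] [RKHS ℂ H₁ Ω ℂ]
  [RKHS ℂ H₂ Ω ℂ]

theorem hilbertTensor_apply_eq_inner_kerVec (F : HilbertTensor H₁ H₂) (z w : Ω) :
    F (z, w) = ⟪tmulL (kerVec H₁ (z : Fin m → ℂ)) (kerVec H₂ (w : Fin m → ℂ)), F⟫_ℂ := by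
  rw [hilbertTensor_apply, kerVec_coe, kerVec_coe]

/-- Both sides vanish off `Ω`, so line derivatives of the extension are literally weak derivatives
of the kernel curve. -/
theorem extend_hilbertTensor_left (F : HilbertTensor H₁ H₂) (z : Ω) (x : Fin m → ℂ) :
    Function.extend Subtype.val (fun x : Ω => F (x, z)) 0 x
      = ⟪tmulL (kerVec H₁ x) (kerVec H₂ (z : Fin m → ℂ)), F⟫_ℂ := by
  by_cases hx : x ∈ Ω
  · lift x to Ω using hx
    rw [Subtype.val_injective.extend_apply, hilbertTensor_apply_eq_inner_kerVec]
  · rw [kerVec_of_notMem hx, map_zero, zero_apply, inner_zero_left,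
      Function.extend_apply']
    · rfl
    · rintro ⟨z, rfl⟩
      exact hx z.2

theorem extend_hilbertTensor_right (F : HilbertTensor H₁ H₂) (z : Ω) (x : Fin m → ℂ) :
    Function.extend Subtype.val (fun x : Ω => F (z, x)) 0 x
      = ⟪tmulL (kerVec H₁ (z : Fin m → ℂ)) (kerVec H₂ x), F⟫_ℂ := by
  by_cases hx : x ∈ Ω
  · lift x to Ω using hx
    rw [Subtype.val_injective.extend_apply, hilbertTensor_apply_eq_inner_kerVec]
  · rw [kerVec_of_notMem hx, map_zero, inner_zero_left, Function.extend_apply']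
    · rfl
    · rintro ⟨z, rfl⟩
      exact hx z.2

theorem mem_A₀_iff {F : HilbertTensor H₁ H₂} : F ∈ A₀ (HilbertTensor H₁ H₂) ↔
    ∀ z : Ω, ⟪tmulL (kerVec H₁ (z : Fin m → ℂ)) (kerVec H₂ (z : Fin m → ℂ)), F⟫_ℂ = 0 := by
  simp only [← hilbertTensor_apply_eq_inner_kerVec]
  rfl

variable {a : Ω → Fin m → H₁} {b : Ω → Fin m → H₂}

theorem hasLineDerivAt_left (ha : ∀ (z : Ω) j, HasWeakDerivAt
      (fun s : ℂ => kerVec H₁ ((z : Fin m → ℂ) + s • Pi.single j 1)) (a z j))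
    (F : HilbertTensor H₁ H₂) (z : Ω) (j : Fin m) :
    HasLineDerivAt ℂ (Function.extend Subtype.val (fun x : Ω => F (x, z)) 0)
      ⟪tmulL (a z j) (kerVec H₂ (z : Fin m → ℂ)), F⟫_ℂ z (Pi.single j 1) := by
  have := (ha z j).tmulL_left (kerVec H₂ (z : Fin m → ℂ)) F
  simpa only [HasLineDerivAt, extend_hilbertTensor_left] using this

theorem hasLineDerivAt_right (hb : ∀ (z : Ω) j, HasWeakDerivAt
      (fun s : ℂ => kerVec H₂ ((z : Fin m → ℂ) + s • Pi.single j 1)) (b z j))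
    (F : HilbertTensor H₁ H₂) (z : Ω) (j : Fin m) :
    HasLineDerivAt ℂ (Function.extend Subtype.val (fun x : Ω => F (z, x)) 0)
      ⟪tmulL (kerVec H₁ (z : Fin m → ℂ)) (b z j), F⟫_ℂ z (Pi.single j 1) := by
  have := (hb z j).tmulL_right (kerVec H₁ (z : Fin m → ℂ)) F
  simpa only [HasLineDerivAt, extend_hilbertTensor_right] using this

/-- The chain rule on the diagonal for functions that vanish there. -/
theorem inner_add_inner_eq_zero_of_mem_A₀ (hΩ : IsOpen Ω)
    (ha : ∀ (z : Ω) j, HasWeakDerivAt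
      (fun s : ℂ => kerVec H₁ ((z : Fin m → ℂ) + s • Pi.single j 1)) (a z j))
    (hb : ∀ (z : Ω) j, HasWeakDerivAt
      (fun s : ℂ => kerVec H₂ ((z : Fin m → ℂ) + s • Pi.single j 1)) (b z j))
    {F : HilbertTensor H₁ H₂} (hF : F ∈ A₀ (HilbertTensor H₁ H₂)) (z : Ω) (j : Fin m) :
    ⟪tmulL (a z j) (kerVec H₂ (z : Fin m → ℂ)), F⟫_ℂ
      + ⟪tmulL (kerVec H₁ (z : Fin m → ℂ)) (b z j), F⟫_ℂ = 0 := by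
  have := (ha z j).inner_tmulL_add_eq_zero (hb z j) (F := F) (by
    filter_upwards [eventually_add_smul_mem hΩ z.2 (Pi.single j 1)] with s hs
    exact mem_A₀_iff.mp hF ⟨_, hs⟩)
  simpa using this

/-- The vectors representing the coordinates of `R₁` at the points of `Ω`. -/
def R₁Vec (α β : ℝ) (a : Ω → Fin m → H₁) (b : Ω → Fin m → H₂) (z : Ω) (j : Fin m) :
    HilbertTensor H₁ H₂ :=
  ((1 / Real.sqrt (α * β * (α + β)) : ℝ) : ℂ) •
    ((β : ℂ) • tmulL (a z j) (kerVec H₂ (z : Fin m → ℂ))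
      - (α : ℂ) • tmulL (kerVec H₁ (z : Fin m → ℂ)) (b z j))

theorem inner_R₁Vec (α β : ℝ) (z : Ω) (j : Fin m) (F : HilbertTensor H₁ H₂) :
    ⟪R₁Vec α β a b z j, F⟫_ℂ = ((1 / Real.sqrt (α * β * (α + β)) : ℝ) : ℂ) *
      ((β : ℂ) * ⟪tmulL (a z j) (kerVec H₂ (z : Fin m → ℂ)), F⟫_ℂ
        - (α : ℂ) * ⟪tmulL (kerVec H₁ (z : Fin m → ℂ)) (b z j), F⟫_ℂ) := by
  simp only [R₁Vec, inner_smul_left, inner_sub_left, Complex.conj_ofReal]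

theorem R₁_apply_eq_inner (ha : ∀ (z : Ω) j, HasWeakDerivAt
      (fun s : ℂ => kerVec H₁ ((z : Fin m → ℂ) + s • Pi.single j 1)) (a z j))
    (hb : ∀ (z : Ω) j, HasWeakDerivAt
      (fun s : ℂ => kerVec H₂ ((z : Fin m → ℂ) + s • Pi.single j 1)) (b z j))
    (α β : ℝ) (F : HilbertTensor H₁ H₂) (z : Ω) (j : Fin m) :
    R₁ α β F z j = ⟪R₁Vec α β a b z j, F⟫_ℂ := by
  rw [inner_R₁Vec, ← (hasLineDerivAt_left ha F z j).lineDeriv,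
    ← (hasLineDerivAt_right hb F z j).lineDeriv]
  rfl

theorem lineDifferentiableAt_eval {σ : Type*} (p : MvPolynomial σ ℂ) {c : (Fin m → ℂ) → σ → ℂ}
    {z v : Fin m → ℂ} (hc : ∀ i, LineDifferentiableAt ℂ (fun x => c x i) z v) :
    LineDifferentiableAt ℂ (fun x => MvPolynomial.eval (c x) p) z v := by
  induction p using MvPolynomial.induction_on with
  | C a => simp [LineDifferentiableAt]
  | add p q hp hq => simpa [LineDifferentiableAt] using DifferentiableAt.fun_add hp hq
  | mul_X p i hp => simpa [LineDifferentiableAt] using DifferentiableAt.fun_mul hp (hc i)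

/-- The product rule on the diagonal: multiplying `F ∈ A₀` by a function `φ` multiplies the
partial derivatives on the diagonal by the values of `φ`. -/
theorem pdOn_mul_of_eq_zero {φ f g : Ω → ℂ} {φ' : (Fin m → ℂ) → ℂ} {j : Fin m} {z : Ω}
    (hφ : ∀ x : Ω, φ x = φ' x) (hd : LineDifferentiableAt ℂ φ' z (Pi.single j 1))
    (hf : LineDifferentiableAt ℂ (Function.extend Subtype.val f 0) (z : Fin m → ℂ)
      (Pi.single j 1)) (hz : f z = 0) (hg : ∀ x, g x = φ x * f x) :
    pdOn j g z = φ z * pdOn j f z := by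
  have hext : Function.extend Subtype.val g 0
      = fun x => φ' x * Function.extend Subtype.val f 0 x := by
    ext x
    by_cases hx : x ∈ Ω
    · lift x to Ω using hx
      rw [Subtype.val_injective.extend_apply, Subtype.val_injective.extend_apply, hg, hφ]
    · have : ¬∃ y : Ω, (y : Fin m → ℂ) = x := by
        rintro ⟨y, rfl⟩
        exact hx y.2
      simp [Function.extend_apply' _ _ _ this]
  have h := HasDerivAt.fun_mul hd.hasLineDerivAt hf.hasLineDerivAt
  have h0 : Function.extend Subtype.val f 0 ((z : Fin m → ℂ) + (0 : ℂ) • Pi.single j 1) = 0 := by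
    rw [zero_smul, add_zero, Subtype.val_injective.extend_apply, hz]
  rw [h0, mul_zero, zero_add, zero_smul, add_zero, ← hφ] at h
  rw [pdOn, hext]
  exact h.deriv

/-- On `A₀` the map `R₁` intertwines the multiplication by a polynomial `p` with the
multiplication by the restriction of `p` to the diagonal. -/
theorem R₁_mul_of_mem_A₀ (ha : ∀ (z : Ω) j, HasWeakDerivAt
      (fun s : ℂ => kerVec H₁ ((z : Fin m → ℂ) + s • Pi.single j 1)) (a z j))
    (hb : ∀ (z : Ω) j, HasWeakDerivAt
      (fun s : ℂ => kerVec H₂ ((z : Fin m → ℂ) + s • Pi.single j 1)) (b z j))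
    (α β : ℝ) (p : MvPolynomial (Fin m ⊕ Fin m) ℂ) {F G : HilbertTensor H₁ H₂}
    (hF : F ∈ A₀ (HilbertTensor H₁ H₂))
    (hG : ∀ x : Ω × Ω, G x = MvPolynomial.eval (coord₂ x) p • F x) (z : Ω) :
    R₁ α β G z = MvPolynomial.eval (coord₂ (z, z)) p • R₁ α β F z := by
  ext j
  have h1 : pdOn j (fun x : Ω => G (x, z)) z
      = MvPolynomial.eval (coord₂ (z, z)) p * pdOn j (fun x : Ω => F (x, z)) z :=
    pdOn_mul_of_eq_zero (φ := fun x => MvPolynomial.eval (coord₂ (x, z)) p)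
      (φ' := fun x => MvPolynomial.eval (Sum.elim x (z : Fin m → ℂ)) p) (fun x => rfl)
      (lineDifferentiableAt_eval p (by
        rintro (i | i) <;> simp only [Sum.elim_inl, Sum.elim_inr] <;>
          exact DifferentiableAt.lineDifferentiableAt (by fun_prop)))
      (hasLineDerivAt_left ha F z j).lineDifferentiableAt (hF z) (fun x => hG (x, z))
  have h2 : pdOn j (fun x : Ω => G (z, x)) z
      = MvPolynomial.eval (coord₂ (z, z)) p * pdOn j (fun x : Ω => F (z, x)) z :=
    pdOn_mul_of_eq_zero (φ := fun x => MvPolynomial.eval (coord₂ (z, x)) p)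
      (φ' := fun x => MvPolynomial.eval (Sum.elim (z : Fin m → ℂ) x) p) (fun x => rfl)
      (lineDifferentiableAt_eval p (by
        rintro (i | i) <;> simp only [Sum.elim_inl, Sum.elim_inr] <;>
          exact DifferentiableAt.lineDifferentiableAt (by fun_prop)))
      (hasLineDerivAt_right hb F z j).lineDifferentiableAt (hF z) (fun x => hG (z, x))
  simp only [R₁, h1, h2, PiLp.smul_apply, smul_eq_mul]
  ring

/-- For `F ∈ A₁` the chain rule on the diagonal makes `∂_j F` vanish along with `∂_{m+j} F`, hence
`R₁ F = 0`. -/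
theorem R₁Vec_mem_S₁ (hΩ : IsOpen Ω) (ha : ∀ (z : Ω) j, HasWeakDerivAt
      (fun s : ℂ => kerVec H₁ ((z : Fin m → ℂ) + s • Pi.single j 1)) (a z j))
    (hb : ∀ (z : Ω) j, HasWeakDerivAt
      (fun s : ℂ => kerVec H₂ ((z : Fin m → ℂ) + s • Pi.single j 1)) (b z j))
    {α β : ℝ} {z : Ω} {j : Fin m}
    (horth : R₁Vec α β a b z j ∈ A₀ (HilbertTensor H₁ H₂)) :
    R₁Vec α β a b z j ∈ S₁ (HilbertTensor H₁ H₂) := by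
  refine ⟨horth, (Submodule.mem_orthogonal' _ _).mpr fun F hF => ?_⟩
  induction hF using Submodule.span_induction with
  | mem F hF =>
    have h1 := inner_add_inner_eq_zero_of_mem_A₀ hΩ ha hb hF.1 z j
    have h2 : ⟪tmulL (kerVec H₁ (z : Fin m → ℂ)) (b z j), F⟫_ℂ = 0 :=
      (hasLineDerivAt_right hb F z j).lineDeriv.symm.trans (hF.2 j z)
    rw [h2, add_zero] at h1
    rw [inner_R₁Vec, h1, h2]
    simp
  | zero => simp
  | add F G _ _ hF hG => rw [inner_add_right, hF, hG, add_zero]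
  | smul c F _ hF => rw [inner_smul_right, hF, mul_zero]

/-- On `A₀` the bracket `β ∂_j - α ∂_{m+j}` equals `-(α + β) ∂_{m+j}` along the diagonal, so `R₁ F =
0` forces `F ∈ A₁`, to which `F` is orthogonal. -/
theorem eq_zero_of_mem_S₁ (hΩ : IsOpen Ω) (ha : ∀ (z : Ω) j, HasWeakDerivAt
      (fun s : ℂ => kerVec H₁ ((z : Fin m → ℂ) + s • Pi.single j 1)) (a z j))
    (hb : ∀ (z : Ω) j, HasWeakDerivAt
      (fun s : ℂ => kerVec H₂ ((z : Fin m → ℂ) + s • Pi.single j 1)) (b z j))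
    {α β : ℝ} (hα : 0 < α) (hβ : 0 < β) {F : HilbertTensor H₁ H₂}
    (hF : F ∈ S₁ (HilbertTensor H₁ H₂)) (h0 : ∀ z j, ⟪R₁Vec α β a b z j, F⟫_ℂ = 0) : F = 0 := by
  have hA₁ : F ∈ A₁ (HilbertTensor H₁ H₂) := by
    refine ⟨hF.1, fun j z => (hasLineDerivAt_right hb F z j).lineDeriv.trans ?_⟩
    have h1 := inner_add_inner_eq_zero_of_mem_A₀ hΩ ha hb hF.1 z j
    have h2 := h0 z j
    rw [inner_R₁Vec, eq_neg_of_add_eq_zero_left h1, mul_eq_zero] at h2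
    have hs : ((1 / Real.sqrt (α * β * (α + β)) : ℝ) : ℂ) ≠ 0 := by
      have : 0 < 1 / Real.sqrt (α * β * (α + β)) := by positivity
      exact_mod_cast this.ne'
    have hab : ((α : ℂ) + β) ≠ 0 := by exact_mod_cast (add_pos hα hβ).ne'
    refine (mul_eq_zero.mp (?_ : ((α : ℂ) + β) * _ = 0)).resolve_left hab
    linear_combination -(h2.resolve_left hs)
  exact inner_self_eq_zero.mp
    (Submodule.inner_right_of_mem_orthogonal (Submodule.subset_span hA₁) hF.2)

end Spaces

/-! ### The Gram matrix of the representing vectors -/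

section Gram

variable {m : ℕ} {Ω : Set (Fin m → ℂ)} {L : (Fin m → ℂ) → (Fin m → ℂ) → ℂ} {α β : ℝ}

theorem kpow_add (z w : Fin m → ℂ) : kpow L (α + β) z w = kpow L α z w * kpow L β z w := by
  simp only [kpow, ← Complex.exp_add]
  push_cast
  ring_nf

theorem curvKernel_apply (z w : Ω) (v : EuclideanSpace ℂ (Fin m)) (i : Fin m) :
    curvKernel Ω L α β z w v i = ∑ j, kpow L (α + β) z w *
      pd i (fun z' => pdbar j (fun w' => L z' w') w) z * v j := by
  simp [curvKernel, Matrix.mulVec, dotProduct]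

variable [Fact (powKernel Ω L α).PosSemidef] [Fact (powKernel Ω L β).PosSemidef]
  {a : Ω → Fin m → PowSpace Ω L α} {b : Ω → Fin m → PowSpace Ω L β}

/-- On the diagonal the two terms are `βα` and `αβ` times the same function, and they cancel. -/
theorem R₁Vec_mem_A₀
    (ha : ∀ (w z : Ω) j, ⟪kerVec (PowSpace Ω L α) (w : Fin m → ℂ), a z j⟫_ℂ
        = α * pdbar j (fun w' => L w w') z * kpow L α w z)
    (hb : ∀ (w z : Ω) j, ⟪kerVec (PowSpace Ω L β) (w : Fin m → ℂ), b z j⟫_ℂ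
        = β * pdbar j (fun w' => L w w') z * kpow L β w z) (z : Ω) (j : Fin m) :
    R₁Vec α β a b z j ∈ A₀ (PowTensor Ω L α β) := by
  refine mem_A₀_iff.mpr fun w => ?_
  rw [← inner_conj_symm, inner_R₁Vec, ← inner_conj_symm, ← inner_conj_symm (tmulL _ (b z j)),
    inner_tmulL, inner_tmulL, ha, hb, inner_kerVec_kerVec w.2 z.2, inner_kerVec_kerVec w.2 z.2]
  simp only [map_mul, map_sub, Complex.conj_conj, Complex.conj_ofReal]
  ring

/-- The products of first derivatives contribute `2α²β² - 2α²β² = 0`; the mixed second derivative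
keeps the factor `αβ² + α²β = αβ(α + β)`, which the normalization removes. -/
theorem inner_R₁Vec_R₁Vec (hα : 0 < α) (hβ : 0 < β)
    (ha₁ : ∀ (w z : Ω) i, ⟪a w i, kerVec (PowSpace Ω L α) (z : Fin m → ℂ)⟫_ℂ
        = α * conj (pdbar i (fun w' => L z w') w) * kpow L α w z)
    (ha₂ : ∀ (w z : Ω) j, ⟪kerVec (PowSpace Ω L α) (w : Fin m → ℂ), a z j⟫_ℂ
        = α * pdbar j (fun w' => L w w') z * kpow L α w z)
    (ha₃ : ∀ (w z : Ω) i j, ⟪a w i, a z j⟫_ℂ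
        = α * (pd i (fun z' => pdbar j (fun w' => L z' w') z) w
          + α * pdbar j (fun w' => L w w') z * conj (pdbar i (fun w' => L z w') w))
          * kpow L α w z)
    (hb₁ : ∀ (w z : Ω) i, ⟪b w i, kerVec (PowSpace Ω L β) (z : Fin m → ℂ)⟫_ℂ
        = β * conj (pdbar i (fun w' => L z w') w) * kpow L β w z)
    (hb₂ : ∀ (w z : Ω) j, ⟪kerVec (PowSpace Ω L β) (w : Fin m → ℂ), b z j⟫_ℂ
        = β * pdbar j (fun w' => L w w') z * kpow L β w z)
    (hb₃ : ∀ (w z : Ω) i j, ⟪b w i, b z j⟫_ℂ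
        = β * (pd i (fun z' => pdbar j (fun w' => L z' w') z) w
          + β * pdbar j (fun w' => L w w') z * conj (pdbar i (fun w' => L z w') w))
          * kpow L β w z) (w z : Ω) (i j : Fin m) :
    ⟪R₁Vec α β a b w i, R₁Vec α β a b z j⟫_ℂ
      = kpow L (α + β) w z * pd i (fun z' => pdbar j (fun w' => L z' w') z) w := by
  have hs : ((1 / Real.sqrt (α * β * (α + β)) : ℝ) : ℂ) *
      ((1 / Real.sqrt (α * β * (α + β)) : ℝ) : ℂ) * (α * β * (α + β)) = 1 := by
    have hpos : 0 < α * β * (α + β) := by positivity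
    have h := Real.mul_self_sqrt hpos.le
    have h0 : Real.sqrt (α * β * (α + β)) ≠ 0 := (Real.sqrt_pos.mpr hpos).ne'
    have : 1 / Real.sqrt (α * β * (α + β)) * (1 / Real.sqrt (α * β * (α + β)))
        * (α * β * (α + β)) = 1 := by
      field_simp
      nlinarith
    exact_mod_cast this
  rw [inner_R₁Vec]
  simp only [R₁Vec, inner_smul_right, inner_sub_right, inner_tmulL, ha₁, ha₂, ha₃, hb₁, hb₂, hb₃,
    inner_kerVec_kerVec w.2 z.2, kpow_add]
  linear_combination (kpow L α w z * kpow L β w z *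
    pd i (fun z' => pdbar j (fun w' => L z' w') z) w) * hs

end Gram

/-! ### The evaluation maps of a family of vectors, and the module structures -/

section CoordEval

variable {X S ι : Type*} [NormedAddCommGroup S] [InnerProductSpace ℂ S]

/-- The vector of the inner products with the vectors `r x j`. -/
def coordEval [Fintype ι] (r : X → ι → S) (x : X) : S →L[ℂ] EuclideanSpace ℂ ι :=
  ((EuclideanSpace.equiv ι ℂ).symm : (ι → ℂ) →L[ℂ] EuclideanSpace ℂ ι) ∘L
    ContinuousLinearMap.pi fun j => innerSL ℂ (r x j)

@[simp]
theorem coordEval_apply [Fintype ι] (r : X → ι → S) (x : X) (f : S) (j : ι) :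
    coordEval r x f j = ⟪r x j, f⟫_ℂ := rfl

theorem coordEval_comp_adjoint_apply [Fintype ι] [CompleteSpace S] (r : X → ι → S) (x y : X)
    (v : EuclideanSpace ℂ ι) (i : ι) :
    (coordEval r x ∘L (coordEval r y).adjoint) v i = ∑ j, ⟪r x i, r y j⟫_ℂ * v j := by
  rw [ContinuousLinearMap.comp_apply, coordEval_apply, ContinuousLinearMap.adjoint_inner_right,
    PiLp.inner_apply]
  refine Finset.sum_congr rfl fun j _ => ?_
  rw [RCLike.inner_apply, coordEval_apply, inner_conj_symm, mul_comm]

end CoordEval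

theorem exists_coordMul_hilbertTensor {m : ℕ} {Ω : Set (Fin m → ℂ)} {H₁ H₂ : Type*}
    [NormedAddCommGroup H₁] [InnerProductSpace ℂ H₁] [CompleteSpace H₁] [RKHS ℂ H₁ Ω ℂ]
    [NormedAddCommGroup H₂] [InnerProductSpace ℂ H₂] [CompleteSpace H₂] [RKHS ℂ H₂ Ω ℂ]
    (h₁ : ∀ i : Fin m, CoordMulBounded H₁ i) (h₂ : ∀ i : Fin m, CoordMulBounded H₂ i)
    (i : Fin m ⊕ Fin m) :
    ∃ T : HilbertTensor H₁ H₂ →L[ℂ] HilbertTensor H₁ H₂,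
      ∀ f (x : Ω × Ω), T f x = coord₂ x i • f x := by
  rcases i with i | i
  · obtain ⟨T, hT⟩ := h₁ i
    refine ⟨mapTensor T (ContinuousLinearMap.id ℂ _), fun f x => ?_⟩
    rw [mapTensor_apply (ψ := fun _ => 1) hT (by simp), mul_one]
    rfl
  · obtain ⟨T, hT⟩ := h₂ i
    refine ⟨mapTensor (ContinuousLinearMap.id ℂ _) T, fun f x => ?_⟩
    rw [mapTensor_apply (φ := fun _ => 1) (by simp) hT, one_mul]
    rfl

/-- Compression is always linear and unital; only multiplicativity can fail, so it is the
hypothesis. -/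
theorem exists_isCompression {A H : Type*} [CommRing A] [Algebra ℂ A] [NormedAddCommGroup H]
    [InnerProductSpace ℂ H] {S : Submodule ℂ H} [S.HasOrthogonalProjection] (ρ : HilbertModule A H)
    (hmul : ∀ (a b : A) (h : S), S.orthogonalProjectionOnto (ρ (a * b) h)
      = S.orthogonalProjectionOnto (ρ a (S.orthogonalProjectionOnto (ρ b h) : S))) :
    ∃ τ : HilbertModule A S, IsCompression S ρ τ := by
  refine ⟨AlgHom.ofLinearMap
    ⟨⟨fun a => S.orthogonalProjectionOnto ∘L ρ a ∘L S.subtypeL, fun a b => ?_⟩, fun c a => ?_⟩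
    ?_ fun a b => ?_, fun a h => rfl⟩
  · ext h
    simp
  · ext h
    simp
  · ext h
    simp
  · exact ContinuousLinearMap.ext fun h => hmul a b h

theorem isClosed_of_hasOrthogonalProjection {H : Type*} [NormedAddCommGroup H]
    [InnerProductSpace ℂ H] (S : Submodule ℂ H) [S.HasOrthogonalProjection] :
    IsClosed (S : Set H) := by
  rw [← S.orthogonal_orthogonal]
  exact Submodule.isClosed_orthogonal _

/-- If the vectors `R₁Vec` lie in `A₀` and their Gram matrix is the kernel `G`, then `R₁` maps `S₁`
unitarily onto the space of `G` and intertwines the module structures. -/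
theorem exists_unitary_module_equiv {m : ℕ} {Ω : Set (Fin m → ℂ)} (hΩ : IsOpen Ω) {H₁ H₂ : Type*}
    [NormedAddCommGroup H₁] [InnerProductSpace ℂ H₁] [CompleteSpace H₁] [RKHS ℂ H₁ Ω ℂ]
    [NormedAddCommGroup H₂] [InnerProductSpace ℂ H₂] [CompleteSpace H₂] [RKHS ℂ H₂ Ω ℂ]
    (h₁ : ∀ i : Fin m, CoordMulBounded H₁ i) (h₂ : ∀ i : Fin m, CoordMulBounded H₂ i)
    {a : Ω → Fin m → H₁} {b : Ω → Fin m → H₂}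
    (ha : ∀ (z : Ω) j, HasWeakDerivAt
      (fun s : ℂ => kerVec H₁ ((z : Fin m → ℂ) + s • Pi.single j 1)) (a z j))
    (hb : ∀ (z : Ω) j, HasWeakDerivAt
      (fun s : ℂ => kerVec H₂ ((z : Fin m → ℂ) + s • Pi.single j 1)) (b z j))
    {α β : ℝ} (hα : 0 < α) (hβ : 0 < β)
    (hA₀ : ∀ z j, R₁Vec α β a b z j ∈ A₀ (HilbertTensor H₁ H₂))
    (G : Matrix Ω Ω (EuclideanSpace ℂ (Fin m) →L[ℂ] EuclideanSpace ℂ (Fin m)))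
    (hG : ∀ w z v i, G w z v i = ∑ j, ⟪R₁Vec α β a b w i, R₁Vec α β a b z j⟫_ℂ * v j) :
    ∃ (ρ : HilbertModule (MvPolynomial (Fin m ⊕ Fin m) ℂ) (HilbertTensor H₁ H₂))
      (τ : HilbertModule (MvPolynomial (Fin m ⊕ Fin m) ℂ) (S₁ (HilbertTensor H₁ H₂)))
      (_ : Fact G.PosSemidef)
      (κ : HilbertModule (MvPolynomial (Fin m) ℂ) (RKHS.OfKernel G))
      (U : S₁ (HilbertTensor H₁ H₂) ≃ₗᵢ[ℂ] RKHS.OfKernel G),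
      IsMultiplicationModule coord₂ ρ ∧
      IsCompression (S₁ (HilbertTensor H₁ H₂)) ρ τ ∧
      IsMultiplicationModule (fun z : Ω => (z : Fin m → ℂ)) κ ∧
      (∀ (f : S₁ (HilbertTensor H₁ H₂)) (z : Ω), U f z = R₁ α β (f : HilbertTensor H₁ H₂) z) ∧
      (∀ (p : MvPolynomial (Fin m ⊕ Fin m) ℂ) (f : S₁ (HilbertTensor H₁ H₂)),
        U (τ p f) = pushForward κ p (U f)) := by
  obtain ⟨ρ, hρ⟩ := exists_isMultiplicationModule (H := HilbertTensor H₁ H₂) coord₂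
    (exists_coordMul_hilbertTensor h₁ h₂)
  have hS : ∀ z j, R₁Vec α β a b z j ∈ S₁ (HilbertTensor H₁ H₂) := fun z j =>
    R₁Vec_mem_S₁ hΩ ha hb (hA₀ z j)
  have hcomplete : CompleteSpace (S₁ (HilbertTensor H₁ H₂)) :=
    (isClosed_of_hasOrthogonalProjection (S₁ (HilbertTensor H₁ H₂))).completeSpace_coe
  let r : Ω → Fin m → S₁ (HilbertTensor H₁ H₂) := fun z j => ⟨R₁Vec α β a b z j, hS z j⟩
  have hr : ∀ z j (f : S₁ (HilbertTensor H₁ H₂)),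
      ⟪r z j, f⟫_ℂ = R₁ α β (f : HilbertTensor H₁ H₂) z j := fun z j f =>
    (R₁_apply_eq_inner ha hb α β f z j).symm
  obtain ⟨hpos, U, hU⟩ := exists_linearIsometryEquiv_ofKernel (coordEval r)
    (fun f hf => Subtype.ext <| eq_zero_of_mem_S₁ hΩ ha hb hα hβ f.2 fun z j =>
      congrArg (fun v : EuclideanSpace ℂ (Fin m) => v j) (hf z))
    G (fun w z => by
      ext v i
      rw [coordEval_comp_adjoint_apply, hG]
      rfl)
  have hUR : ∀ (f : S₁ (HilbertTensor H₁ H₂)) (z : Ω), U f z = R₁ α β (f : HilbertTensor H₁ H₂) z := by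
    intro f z
    ext j
    rw [hU, coordEval_apply, hr]
  let P := (S₁ (HilbertTensor H₁ H₂)).orthogonalProjectionOnto
  -- `P` is invisible to `R₁`, whose representing vectors lie in `S₁`.
  have hUP : ∀ (p : MvPolynomial (Fin m ⊕ Fin m) ℂ) (f : S₁ (HilbertTensor H₁ H₂)) (z : Ω),
      U (P (ρ p f)) z = MvPolynomial.eval (coord₂ (z, z)) p • U f z := by
    intro p f z
    rw [hUR f, ← R₁_mul_of_mem_A₀ ha hb α β p (S₁_le_A₀ f.2) (hρ p f) z]
    ext j
    rw [hUR, R₁_apply_eq_inner ha hb, R₁_apply_eq_inner ha hb]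
    exact Submodule.inner_orthogonalProjectionOnto_eq_of_mem_left (r z j) (ρ p f)
  -- Multiplicativity is checked after applying `U`, where the action is pointwise multiplication.
  obtain ⟨τ, hτ⟩ := exists_isCompression ρ fun p q f => U.injective <| RKHS.ext fun z => by
    rw [hUP, hUP, hUP, map_mul, mul_smul]
  -- Lifting `p` to the first `m` variables restricts back to `p` on the diagonal, so conjugating
  -- the compressed action by `U` bounds multiplication by `p`.
  obtain ⟨κ, hκ⟩ := exists_isMultiplicationModule_of_forall (H := RKHS.OfKernel G)
    (fun z : Ω => (z : Fin m → ℂ)) fun p => by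
      refine ⟨(U.toContinuousLinearEquiv : _ →L[ℂ] _) ∘L
        τ (MvPolynomial.rename Sum.inl p) ∘L
        (U.symm.toContinuousLinearEquiv : _ →L[ℂ] _), fun f z => ?_⟩
      have h := hUP (MvPolynomial.rename Sum.inl p) (U.symm f) z
      rw [← hτ, MvPolynomial.eval_rename, U.apply_symm_apply] at h
      exact h
  refine ⟨ρ, τ, hpos, κ, U, hρ, hτ, hκ, hUR, fun p f => RKHS.ext fun z => ?_⟩
  rw [hτ, hUP]
  refine Eq.trans ?_ (hκ (MvPolynomial.rename (Sum.elim id id) p) (U f) z).symm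
  rw [MvPolynomial.eval_rename]
  congr 3
  ext (i | i) <;> rfl

end TwoBox

end

open TwoBox in
theorem theorem3p7 {m : ℕ} (Ω : Set (Fin m → ℂ)) (hΩo : IsOpen Ω) (hΩc : IsConnected Ω)
    (hΩb : Bornology.IsBounded Ω)
    (K L : (Fin m → ℂ) → (Fin m → ℂ) → ℂ) (hK : IsSesquiAnalytic Ω K) (hL : IsLogBranch Ω K L)
    (α β : ℝ) (hα : 0 < α) (hβ : 0 < β)
    [hKα : Fact (powKernel Ω L α).PosSemidef] [hKβ : Fact (powKernel Ω L β).PosSemidef]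
    (hMα : ∀ i : Fin m, CoordMulBounded (PowSpace Ω L α) i)
    (hMβ : ∀ i : Fin m, CoordMulBounded (PowSpace Ω L β) i) :
    ∃ (ρ : HilbertModule (MvPolynomial (Fin m ⊕ Fin m) ℂ) (PowTensor Ω L α β))
      (τ : HilbertModule (MvPolynomial (Fin m ⊕ Fin m) ℂ) (S₁ (PowTensor Ω L α β)))
      (_ : Fact (curvKernel Ω L α β).PosSemidef)
      (κ : HilbertModule (MvPolynomial (Fin m) ℂ) (CurvSpace Ω L α β))
      (U : S₁ (PowTensor Ω L α β) ≃ₗᵢ[ℂ] CurvSpace Ω L α β),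
      IsMultiplicationModule coord₂ ρ ∧
      IsCompression (S₁ (PowTensor Ω L α β)) ρ τ ∧
      IsMultiplicationModule (fun z : Ω => (z : Fin m → ℂ)) κ ∧
      (∀ (f : S₁ (PowTensor Ω L α β)) (z : Ω), U f z = R₁ α β (f : PowTensor Ω L α β) z) ∧
      (∀ (p : MvPolynomial (Fin m ⊕ Fin m) ℂ) (f : S₁ (PowTensor Ω L α β)),
        U (τ p f) = pushForward κ p (U f)) := by
  obtain ⟨a, ha, ha₁, ha₂, ha₃⟩ := exists_derivative_vectors (t := α) hΩo hK hL hα.ne'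
  obtain ⟨b, hb, hb₁, hb₂, hb₃⟩ := exists_derivative_vectors (t := β) hΩo hK hL hβ.ne'
  refine exists_unitary_module_equiv hΩo hMα hMβ ha hb hα hβ (R₁Vec_mem_A₀ ha₂ hb₂)
    (curvKernel Ω L α β) fun w z v i => ?_
  rw [curvKernel_apply]
  refine Finset.sum_congr rfl fun j _ => ?_
  rw [inner_R₁Vec_R₁Vec hα hβ ha₁ ha₂ ha₃ hb₁ hb₂ hb₃]
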